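/- Let $X$ be a locally compact Hausdorff space, let $k:X\times X\to[0,+\infty]$ be lower semicontinuous and symmetric ($k(x,y)=k(y,x)$ for all $x,y\in X$), and let $K\subset X$ be nonempty and compact. For $E\subset[0,+\infty]$ let $\overline{\mathrm{conv}}\,E$ be the smallest closed subinterval of $[0,+\infty]$ containing $E$ (so $\overline{\mathrm{conv}}\,E=[\inf E,\sup E]$ for $E\neq\emptyset$). Let $\mathfrak M_1(K)$ be the set of regular Borel probability measures $\mu$ on $X$ with $\mu(X\setminus K)=0$, and for $\mu\in\mathfrak M_1(K)$ put $U^\mu(x)=\int_X k(x,y)\,d\mu(y)\in[0,+\infty]$. Define the average set of $K$ by $$A(K)=\bigcap_{\mu\in\mathfrak M_1(K)}\overline{\mathrm{conv}}\,\{U^\mu(x): x\in K\}$$ and the rendezvous set of $K$ by $$R(K)=\bigcap_{n=1}^{\infty}\ \bigcap_{w_1,\dots,w_n\in K}\overline{\mathrm{conv}}\,\Bigl\{\tfrac1n\sum_{j=1}^n k(x,w_j): x\in K\Bigr\},$$ where the points $w_1,\dots,w_n$ need not be distinct. Then $A(K)$ consists of exactly one point of $[0,+\infty]$. If, moreover,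 $k$ is finite-valued and continuous on $X\times X$, then $R(K)$ also consists of exactly one point. -/

import Mathlib

open MeasureTheory
open scoped ENNReal

namespace Rendezvous

/-- The closed convex hull of `E` in the compact half-line `[0, ∞]`: the smallest closed
order-convex subset of `[0, ∞]` that contains `E`. Convexity is meant in the order sense, so that
for instance the closed convex hull of `{0, ∞}` is `[0, ∞]`. -/
def closedConv (E : Set ℝ≥0∞) : Set ℝ≥0∞ :=
  ⋂₀ {I : Set ℝ≥0∞ | IsClosed I ∧ I.OrdConnected ∧ E ⊆ I}

/-- The closed convex hull is the closed interval from the infimum to the supremum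
(for `E = ∅` this is the interval `[∞, 0] = ∅`). -/
theorem closedConv_eq_Icc (E : Set ℝ≥0∞) : closedConv E = Set.Icc (sInf E) (sSup E) := by
  apply Set.Subset.antisymm
  · exact Set.sInter_subset_of_mem
      ⟨isClosed_Icc, Set.ordConnected_Icc, fun x hx => ⟨sInf_le hx, le_sSup hx⟩⟩
  · rcases E.eq_empty_or_nonempty with rfl | hE
    · simp
    · rintro x hx I ⟨hc, ho, hs⟩
      have h1 : sInf E ∈ I := closure_minimal hs hc (sInf_mem_closure hE)
      have h2 : sSup E ∈ I := closure_minimal hs hc (sSup_mem_closure hE)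
      exact ho.out h1 h2 hx

variable {X : Type*}

/-- The `n`-th (weak) rendezvous set `R_n(H, L)` of `L` with respect to `H`: the intersection, over
all `w₁, …, wₙ ∈ H` (repetitions allowed), of the closed convex hulls of the sets of averages
`(1 / n) ∑ⱼ k(x, wⱼ)`, `x ∈ L`. It is used for `n ≥ 1`. -/
noncomputable def nthRendezvousSet₂ (k : X → X → ℝ≥0∞) (n : ℕ) (H L : Set X) : Set ℝ≥0∞ :=
  ⋂ (w : Fin n → X) (_ : ∀ j, w j ∈ H),
    closedConv ((fun x => (n : ℝ≥0∞)⁻¹ * ∑ j, k x (w j)) '' L)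

/-- The (weak) rendezvous set `R(H, L) = ⋂_{n ≥ 1} R_n(H, L)`. -/
noncomputable def rendezvousSet₂ (k : X → X → ℝ≥0∞) (H L : Set X) : Set ℝ≥0∞ :=
  ⋂ (n : ℕ) (_ : 1 ≤ n), nthRendezvousSet₂ k n H L

/-- The (weak) rendezvous set `R(H) = R(H, H)`. -/
noncomputable def rendezvousSet (k : X → X → ℝ≥0∞) (H : Set X) : Set ℝ≥0∞ :=
  rendezvousSet₂ k H H

/-- The potential `U^μ(x) = ∫ k(x, y) dμ(y)`. -/
noncomputable def potential [MeasurableSpace X] (k : X → X → ℝ≥0∞) (μ : Measure X) (x : X) :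
    ℝ≥0∞ :=
  ∫⁻ y, k x y ∂μ

/-- The set `𝔐₁(H)` of regular Borel probability measures on `X` concentrated on `H`. The value
`μ Hᶜ` is that of the outer measure induced by `μ`, so `H` may be any subset of `X`. -/
def probMeasuresOn [TopologicalSpace X] [MeasurableSpace X] (H : Set X) : Set (Measure X) :=
  {μ | IsProbabilityMeasure μ ∧ μ.Regular ∧ μ Hᶜ = 0}

/-- The (weak) average set `A(H, L)` of `L` with respect to `H`. -/
noncomputable def averageSet₂ [TopologicalSpace X] [MeasurableSpace X] (k : X → X → ℝ≥0∞)
    (H L : Set X) : Set ℝ≥0∞ :=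
  ⋂ μ ∈ probMeasuresOn H, closedConv (potential k μ '' L)

/-- The (weak) average set `A(H) = A(H, H)`. -/
noncomputable def averageSet [TopologicalSpace X] [MeasurableSpace X] (k : X → X → ℝ≥0∞)
    (H : Set X) : Set ℝ≥0∞ :=
  averageSet₂ k H H

end Rendezvous

namespace Rendezvous

open Set Filter Topology
open scoped NNReal BoundedContinuousFunction

/-! A point r lies in A(K) exactly when inf_K U^μ ≤ r ≤ sup_K U^μ for every μ, so the claim is the
minimax identity sup_μ inf_K U^μ = inf_μ sup_K U^μ. Both sides are compared with `maximinValue`, the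
left side restricted to finitely supported μ. For such μ the interchange of integrals is a finite
sum, so weak duality needs only symmetry and measurable sections, not a product measure.

Restriction to finite support loses nothing (`iInf_potential_le_maximinValue`): k(x,·) is
approximated from below by continuous functions, finitely many of which suffice for all x in K by
lower semicontinuity and compactness; their integrals are then discretized simultaneously.

Conversely, let c exceed the maximin value. Separation of convex sets in a finite-dimensional space
gives, for each finite set of test points, a discrete measure with potential at most c there. A weak
cluster point along the finite subsets of K has potential at most c on all of K
(`exists_potential_le`), since potentials are lower semicontinuous in the measure.

For finite continuous k, uniform control of k(x,·) in x replaces the limit, so discrete measures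
suffice on both sides; boundedness of k on K × K lets equal-weight averages approximate them
uniformly. -/

/-! ### Finite minimax by separation -/

/-- A finite minimax theorem for families of `[0, ∞]`-valued functions. -/
theorem exists_weights_sum_le {Y ι : Type*} [Fintype ι] [Nonempty ι] (φ : ι → Y → ℝ≥0∞)
    (K : Set Y) (a c : ℝ≥0) (hac : a < c)
    (h : ∀ l : ι → ℝ≥0, ∑ i, l i = 1 → ∃ y ∈ K, ∑ i, (l i : ℝ≥0∞) * φ i y ≤ a) :
    ∃ (J : Type) (_ : Fintype J) (w : J → ℝ≥0) (z : J → Y), ∑ j, w j = 1 ∧ (∀ j, z j ∈ K) ∧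
      ∀ i, ∑ j, (w j : ℝ≥0∞) * φ i (z j) ≤ c := by
  classical
  -- Only points of D have an image in real coordinates. Strictly positive weights are needed to
  -- force a point into D, because 0 * ∞ = 0 hides infinite values.
  let D : Set Y := {y ∈ K | ∀ i, φ i y ≠ ∞}
  have hfin : ∀ l : ι → ℝ≥0, (∀ i, 0 < l i) → ∀ y, ∑ i, (l i : ℝ≥0∞) * φ i y ≤ a →
      ∀ i, φ i y ≠ ∞ := by
    intro l hl y hy i hi
    have h1 : (l i : ℝ≥0∞) * φ i y ≤ a :=
      (Finset.single_le_sum (f := fun i => (l i : ℝ≥0∞) * φ i y) (fun _ _ => zero_le)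
        (Finset.mem_univ i)).trans hy
    rw [hi, ENNReal.mul_top (by exact_mod_cast (hl i).ne')] at h1
    exact absurd h1 (by simp)
  let F : Y → ι → ℝ := fun y i => (φ i y).toReal
  have hm : (0 : ℝ≥0) < Fintype.card ι := by exact_mod_cast Fintype.card_pos
  have hunif : ∑ _i : ι, (Fintype.card ι : ℝ≥0)⁻¹ = 1 := by
    simp [hm.ne']
  have hDne : D.Nonempty := by
    obtain ⟨y, hyK, hy⟩ := h (fun _ => (Fintype.card ι : ℝ≥0)⁻¹) hunif
    exact ⟨y, hyK, hfin _ (fun _ => inv_pos.2 hm) y hy⟩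
  let T : Set (ι → ℝ) := Set.univ.pi fun _ => Iio (c : ℝ)
  have hT : IsOpen T := isOpen_set_pi finite_univ fun _ _ => isOpen_Iio
  have hTc : Convex ℝ T := convex_pi fun _ _ => convex_Iio _
  by_cases hdis : Disjoint T (convexHull ℝ (F '' D))
  · exfalso
    obtain ⟨f, u, hfT, hfC⟩ := geometric_hahn_banach_open hTc hT (convex_convexHull ℝ _) hdis
    let l : ι → ℝ := fun i => f (Pi.single i 1)
    have hf : ∀ t : ι → ℝ, f t = ∑ i, t i * l i := by
      intro t
      have := LinearMap.pi_apply_eq_sum_univ (f : (ι → ℝ) →ₗ[ℝ] ℝ) t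
      have hsingle : ∀ i : ι, (fun j => if i = j then (1 : ℝ) else 0) = Pi.single i 1 := fun i => by
        ext j; simp [Pi.single_apply, eq_comm]
      simpa [l, hsingle] using this
    -- T is unbounded below in each coordinate, so a negative coefficient would make f unbounded
    -- above on T.
    have hl0 : ∀ i, 0 ≤ l i := by
      intro i
      by_contra! hi
      have key : ∀ s : ℝ, 0 ≤ s → (c - 1 : ℝ) * ∑ j, l j - s * l i < u := by
        intro s hs
        have hmem : (fun j => (c - 1 : ℝ) - s * (if j = i then 1 else 0)) ∈ T := by
          intro j _
          simp only [mem_Iio]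
          split_ifs <;> nlinarith
        have := hfT _ hmem
        rw [hf] at this
        simpa [sub_mul, Finset.sum_sub_distrib, Finset.mul_sum] using this
      have := key ((|u| + |(c - 1 : ℝ) * ∑ j, l j|) / (-l i))
        (div_nonneg (by positivity) (by linarith))
      rw [div_mul_eq_mul_div, div_neg, mul_div_assoc, div_self hi.ne] at this
      have h1 := le_abs_self u
      have h2 := neg_abs_le ((c - 1 : ℝ) * ∑ j, l j)
      linarith
    set S := ∑ i, l i with hS
    have hS0 : 0 < S := by
      refine lt_of_le_of_ne (Finset.sum_nonneg fun i _ => hl0 i) fun h0 => ?_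
      have hz : ∀ i, l i = 0 := fun i =>
        (Finset.sum_eq_zero_iff_of_nonneg fun i _ => hl0 i).1 h0.symm i (Finset.mem_univ i)
      have hf0 : ∀ t, f t = 0 := fun t => by simp [hf, hz]
      obtain ⟨y, hy⟩ := hDne
      have h1 := hfC _ (subset_convexHull ℝ _ ⟨y, hy, rfl⟩)
      have h2 := hfT (fun _ => (c : ℝ) - 1) (fun i _ => by simp)
      rw [hf0] at h1 h2
      linarith
    have hcu : ∀ s : ℝ, s < c → s * S < u := by
      intro s hs
      have := hfT (fun _ => s) (fun i _ => hs)
      rwa [hf, ← Finset.mul_sum] at this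
    have hcu' : (c : ℝ) * S ≤ u := by
      by_contra! hlt
      have := hcu (u / S) (by rwa [div_lt_iff₀ hS0])
      rw [div_mul_cancel₀ _ hS0.ne'] at this
      exact lt_irrefl _ this
    have hFy : ∀ y ∈ D, (c : ℝ) * S ≤ ∑ i, F y i * l i := fun y hy => by
      rw [← hf]; exact hcu'.trans (hfC _ (subset_convexHull ℝ _ ⟨y, hy, rfl⟩))
    have hac' : (a : ℝ) < c := hac
    have hc0 : (0 : ℝ) < c := lt_of_le_of_lt a.2 hac'
    -- Mixing in the uniform weights with mass ε makes all weights positive, while (1 - ε) * c = (a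
    -- + c) / 2 still exceeds a.
    let ε : ℝ := (c - a) / (2 * c)
    have hε0 : 0 < ε := div_pos (by linarith) (by linarith)
    have hε1 : ε < 1 := by
      rw [div_lt_one (by linarith)]
      have := a.2
      linarith
    have hεc : ε * c = (c - a) / 2 := by
      simp only [ε]; field_simp
    let p : ι → ℝ := fun i => (1 - ε) * (l i / S) + ε * (Fintype.card ι : ℝ)⁻¹
    have hmR : (0 : ℝ) < Fintype.card ι := by exact_mod_cast hm
    have hp0 : ∀ i, 0 < p i := fun i => by
      have := div_nonneg (hl0 i) hS0.le
      have : 0 ≤ (1 - ε) * (l i / S) := mul_nonneg (by linarith) this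
      have : 0 < ε * (Fintype.card ι : ℝ)⁻¹ := by positivity
      simp only [p]; linarith
    have hp1 : ∑ i, p i = 1 := by
      simp only [p, Finset.sum_add_distrib, ← Finset.mul_sum, ← Finset.sum_div, ← hS,
        div_self hS0.ne', Finset.sum_const, Finset.card_univ, nsmul_eq_mul]
      field_simp
      ring
    obtain ⟨q, hq⟩ : ∃ q : ι → ℝ≥0, ∀ i, (q i : ℝ) = p i :=
      ⟨fun i => ⟨p i, (hp0 i).le⟩, fun _ => rfl⟩
    obtain ⟨y, hyK, hy⟩ := h q (by rw [← NNReal.coe_inj]; push_cast; simpa only [hq] using hp1)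
    have hyfin := hfin q (fun i => by rw [← NNReal.coe_pos, hq]; exact hp0 i) y hy
    have hyD : y ∈ D := ⟨hyK, hyfin⟩
    have h1 : ∑ i, p i * F y i ≤ a := by
      have := ENNReal.toReal_mono ENNReal.coe_ne_top hy
      rw [ENNReal.toReal_sum (fun i _ => ENNReal.mul_ne_top ENNReal.coe_ne_top (hyfin i))] at this
      simpa [F, ENNReal.toReal_mul, hq] using this
    have h2 : (1 - ε) * c ≤ ∑ i, p i * F y i := by
      calc (1 - ε) * c ≤ (1 - ε) * ((∑ i, F y i * l i) / S) := by
            refine mul_le_mul_of_nonneg_left ?_ (by linarith)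
            rw [le_div_iff₀ hS0]; exact hFy y hyD
        _ = ∑ i, (1 - ε) * (l i / S) * F y i := by
            rw [Finset.sum_div, Finset.mul_sum]
            exact Finset.sum_congr rfl fun i _ => by ring
        _ ≤ _ := by
            refine Finset.sum_le_sum fun i _ => mul_le_mul_of_nonneg_right ?_ ENNReal.toReal_nonneg
            simp only [p]
            have : 0 < ε * (Fintype.card ι : ℝ)⁻¹ := by positivity
            linarith
    nlinarith
  · obtain ⟨t, htT, htC⟩ := not_disjoint_iff.1 hdis
    obtain ⟨J, hJ, w, z, hw0, hw1, hz, hwz⟩ := mem_convexHull_iff_exists_fintype.1 htC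
    choose y hyD hyz using hz
    obtain ⟨q, hq⟩ : ∃ q : J → ℝ≥0, ∀ j, (q j : ℝ) = w j := ⟨fun j => ⟨w j, hw0 j⟩, fun _ => rfl⟩
    refine ⟨J, hJ, q, y, by rw [← NNReal.coe_inj]; push_cast; simpa only [hq] using hw1,
      fun j => (hyD j).1, fun i => ?_⟩
    have hne : ∀ j ∈ Finset.univ, (q j : ℝ≥0∞) * φ i (y j) ≠ ∞ := fun j _ =>
      ENNReal.mul_ne_top ENNReal.coe_ne_top ((hyD j).2 i)
    rw [← ENNReal.toReal_le_toReal (ENNReal.sum_ne_top.2 hne) ENNReal.coe_ne_top,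
      ENNReal.toReal_sum hne]
    have h1 : t i < c := htT i (mem_univ i)
    rw [← hwz] at h1
    refine le_trans (le_of_eq ?_) h1.le
    simp [← hyz, F, ENNReal.toReal_mul, hq]

/-! ### Continuous minorants of lower semicontinuous functions -/

/-- For a continuous function `f` and a lower semicontinuous function `g`, the set `{f < g}` is
open. -/
theorem isOpen_lt_of_lowerSemicontinuous {Y : Type*} [TopologicalSpace Y] {f g : Y → ℝ≥0∞}
    (hf : Continuous f) (hg : LowerSemicontinuous g) : IsOpen {y | f y < g y} := by
  rw [isOpen_iff_mem_nhds]
  intro y hy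
  obtain ⟨q, hq1, hq2⟩ := exists_between (show f y < g y from hy)
  filter_upwards [hf.continuousAt.eventually (gt_mem_nhds hq1), hg y q hq2] with y' h1 h2
  exact h1.trans h2

/-- Insertion, up to `ε` and on a compact set, of a bounded continuous function between an upper
semicontinuous function and a lower semicontinuous one. -/
theorem exists_boundedContinuous_between {X : Type*} [TopologicalSpace X] [LocallyCompactSpace X]
    [T2Space X] {K : Set X} (hK : IsCompact K) {g : X → ℝ≥0∞} (hg : LowerSemicontinuous g)
    {u : X → ℝ≥0} (hu : UpperSemicontinuous u) (hug : ∀ x, (u x : ℝ≥0∞) ≤ g x) {ε : ℝ≥0}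
    (hε : 0 < ε) :
    ∃ f : X →ᵇ ℝ≥0, (∀ x, (f x : ℝ≥0∞) ≤ g x) ∧ ∀ x ∈ K, u x ≤ f x + ε := by
  suffices H : ∃ f : X → ℝ≥0, Continuous f ∧ (∃ C, ∀ x, f x ≤ C) ∧ (∀ x, (f x : ℝ≥0∞) ≤ g x) ∧
      ∀ x ∈ K, u x ≤ f x + ε by
    obtain ⟨f, hf, ⟨C, hC⟩, h1, h2⟩ := H
    refine ⟨BoundedContinuousFunction.mkOfBound ⟨f, hf⟩ C fun x y => ?_, h1, h2⟩
    rw [NNReal.dist_eq]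
    have hx : (f x : ℝ) ≤ C := hC x
    have hy : (f y : ℝ) ≤ C := hC y
    exact abs_sub_le_iff.2
      ⟨by simpa using by linarith [(f y).2], by simpa using by linarith [(f x).2]⟩
  refine hK.induction_on (p := fun K => ∃ f : X → ℝ≥0, Continuous f ∧ (∃ C, ∀ x, f x ≤ C) ∧
    (∀ x, (f x : ℝ≥0∞) ≤ g x) ∧ ∀ x ∈ K, u x ≤ f x + ε) ?_ (fun s t hst h => ?_)
    (fun s t hs ht => ?_) (fun y hy => ?_)
  · exact ⟨0, continuous_zero, ⟨0, by simp⟩, by simp, by simp⟩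
  · obtain ⟨f, h1, h2, h3, h4⟩ := h
    exact ⟨f, h1, h2, h3, fun x hx => h4 x (hst hx)⟩
  · obtain ⟨f, h1, ⟨C, h2⟩, h3, h4⟩ := hs
    obtain ⟨f', h1', ⟨C', h2'⟩, h3', h4'⟩ := ht
    refine ⟨fun x => max (f x) (f' x), h1.max h1', ⟨max C C', fun x => max_le_max (h2 x) (h2' x)⟩,
      fun x => by simpa using ⟨h3 x, h3' x⟩, ?_⟩
    rintro x (hx | hx)
    · exact (h4 x hx).trans (by gcongr; exact le_max_left _ _)
    · exact (h4' x hx).trans (by gcongr; exact le_max_right _ _)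
  · rcases lt_or_ge (u y) ε with h0 | h0
    · refine ⟨{x | u x < ε}, mem_nhdsWithin_of_mem_nhds (hu y ε h0), 0, continuous_zero,
        ⟨0, by simp⟩, by simp, fun x hx => ?_⟩
      simpa using (show u x < ε from hx).le
    · have hlt : ((u y - ε / 2 : ℝ≥0) : ℝ≥0∞) < g y := by
        refine lt_of_lt_of_le ?_ (hug y)
        exact_mod_cast tsub_lt_self (hε.trans_le h0) (half_pos hε)
      -- The local minorant is t times a Urysohn function vanishing off {t < g}. Near y one has u <
      -- t + 3ε/4 and f > t - ε/4, hence u < f + ε.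
      set t : ℝ≥0 := u y - ε / 2 with ht
      have hut : u y = t + ε / 2 := by
        rw [ht, tsub_add_cancel_of_le]
        exact (half_le_self hε.le).trans h0
      have hopen : IsOpen {x | (t : ℝ≥0∞) < g x} := hg.isOpen_preimage _
      obtain ⟨χ, hχ1, hχ0, -, hχ⟩ := exists_continuous_one_zero_of_isCompact
        (isCompact_singleton (x := y)) hopen.isClosed_compl
        (by simpa [disjoint_singleton_left] using hlt)
      let f : X → ℝ≥0 := fun x => t * (χ x).toNNReal
      have hfc : Continuous f := by fun_prop
      have hfy : f y = t := by
        have : χ y = 1 := hχ1 rfl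
        simp [f, this]
      have hft : ∀ x, f x ≤ t := fun x => by
        have : (χ x).toNNReal ≤ 1 := by simpa using (hχ x).2
        simpa [f] using mul_le_mul_right this t
      refine ⟨{x | u x < t + ε / 2 + ε / 4 ∧ t < f x + ε / 4}, ?_, f, hfc, ⟨t, hft⟩, ?_, ?_⟩
      · refine mem_nhdsWithin_of_mem_nhds (Filter.inter_mem (hu y _ ?_) ?_)
        · change u y < _
          rw [hut]; exact lt_add_of_pos_right _ (by positivity)
        · refine (isOpen_lt continuous_const (by fun_prop)).mem_nhds ?_
          change t < f y + ε / 4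
          rw [hfy]
          exact lt_add_of_pos_right _ (div_pos hε (by norm_num))
      · intro x
        by_cases hx : (t : ℝ≥0∞) < g x
        · exact (by exact_mod_cast hft x : (f x : ℝ≥0∞) ≤ t).trans hx.le
        · have : χ x = 0 := hχ0 hx
          simp [f, this]
      · rintro x ⟨h1, h2⟩
        rw [← NNReal.coe_le_coe]
        rw [← NNReal.coe_lt_coe] at h1 h2
        push_cast at *
        linarith

/-- Integrals of lower semicontinuous functions against a regular probability measure on a compact
set are approximated from below by integrals of bounded continuous minorants. -/
theorem exists_boundedContinuous_lt_lintegral {X : Type*} [TopologicalSpace X]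
    [LocallyCompactSpace X] [T2Space X] [MeasurableSpace X] [BorelSpace X] {K : Set X}
    (hK : IsCompact K) {μ : Measure X} (hμ : μ ∈ probMeasuresOn K) {g : X → ℝ≥0∞}
    (hg : LowerSemicontinuous g) {c : ℝ≥0} (hc : (c : ℝ≥0∞) < ∫⁻ x, g x ∂μ) :
    ∃ f : X →ᵇ ℝ≥0, (∀ x, (f x : ℝ≥0∞) ≤ g x) ∧ (c : ℝ≥0∞) < ∫⁻ x, f x ∂μ := by
  obtain ⟨hP, hR, hμK⟩ := hμ
  rw [lintegral_eq_nnreal] at hc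
  simp only [lt_iSup_iff] at hc
  obtain ⟨s, hsg, hs⟩ := hc
  rw [← SimpleFunc.lintegral_eq_lintegral] at hs
  have hsfin : ∫⁻ x, s x ∂μ ≠ ∞ := by
    obtain ⟨C, hC⟩ := s.finite_range.bddAbove
    refine ((lintegral_mono (g := fun _ => (C : ℝ≥0∞)) fun x => ?_).trans_lt (by simp)).ne
    exact ENNReal.coe_le_coe.2 (hC (mem_range_self x))
  have hs' : (c : ℝ≥0∞) < ∫⁻ x, s x ∂μ := hs
  -- The gap d - c pays for two losses of (d - c) / 2: from s down to the upper semicontinuous u,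
  -- and from u to f.
  obtain ⟨d, hd1, hd2⟩ := ENNReal.lt_iff_exists_nnreal_btwn.1 hs'
  have hcd : c < d := by exact_mod_cast hd1
  have hεpos : 0 < (d - c) / 2 := half_pos (tsub_pos_of_lt hcd)
  obtain ⟨u, hus, hu, hint⟩ := SimpleFunc.exists_upperSemicontinuous_le_lintegral_le s hsfin
    (ε := ((d - c) / 2 : ℝ≥0)) (by exact_mod_cast hεpos.ne')
  obtain ⟨f, hfg, hfu⟩ := exists_boundedContinuous_between hK hg hu
    (fun x => le_trans (by exact_mod_cast hus x) (hsg x)) hεpos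
  refine ⟨f, hfg, ?_⟩
  have h1 : ∫⁻ x, u x ∂μ ≤ ∫⁻ x, f x ∂μ + ((d - c) / 2 : ℝ≥0) := by
    calc ∫⁻ x, u x ∂μ ≤ ∫⁻ x, ((f x : ℝ≥0∞) + ((d - c) / 2 : ℝ≥0)) ∂μ := by
          refine lintegral_mono_ae ?_
          filter_upwards [mem_ae_iff.2 hμK] with x hx
          exact_mod_cast hfu x hx
      _ = _ := by rw [lintegral_add_right _ measurable_const]; simp
  have h2 : (d : ℝ≥0∞) < ∫⁻ x, f x ∂μ + (d - c : ℝ≥0) := by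
    refine hd2.trans_le (hint.trans ((add_le_add_left h1 _).trans ?_))
    rw [add_assoc, ← ENNReal.coe_add, add_halves]
  by_contra! hle
  refine absurd (h2.trans_le (add_le_add_left hle _)) ?_
  rw [← ENNReal.coe_add, add_tsub_cancel_of_le hcd.le]
  exact lt_irrefl _

/-! ### Finitely supported measures -/

section Discrete

variable {X : Type*} [MeasurableSpace X]

/-- The measure `∑ j, w j • δ_{z j}`. -/
noncomputable def discreteMeasure {J : Type} [Fintype J] (w : J → ℝ≥0) (z : J → X) : Measure X :=
  ∑ j, (w j : ℝ≥0∞) • Measure.dirac (z j)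

/-- The finitely supported probability measures carried by `K`. -/
def discreteProbOn (K : Set X) : Set (Measure X) :=
  {μ | ∃ (J : Type) (_ : Fintype J) (w : J → ℝ≥0) (z : J → X), ∑ j, w j = 1 ∧ (∀ j, z j ∈ K) ∧
    μ = discreteMeasure w z}

theorem lintegral_discreteMeasure [MeasurableSingletonClass X] {J : Type} [Fintype J]
    (w : J → ℝ≥0) (z : J → X) (g : X → ℝ≥0∞) :
    ∫⁻ x, g x ∂(discreteMeasure w z) = ∑ j, (w j : ℝ≥0∞) * g (z j) := by
  rw [discreteMeasure, lintegral_finsetSum_measure]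
  exact Finset.sum_congr rfl fun j _ => by rw [lintegral_smul_measure, lintegral_dirac, smul_eq_mul]

theorem potential_discreteMeasure [MeasurableSingletonClass X] {J : Type} [Fintype J]
    (k : X → X → ℝ≥0∞) (w : J → ℝ≥0) (z : J → X) (x : X) :
    potential k (discreteMeasure w z) x = ∑ j, (w j : ℝ≥0∞) * k x (z j) :=
  lintegral_discreteMeasure w z (k x)

theorem discreteProbOn_subset [TopologicalSpace X] [T2Space X] [BorelSpace X] {K : Set X} :
    discreteProbOn K ⊆ probMeasuresOn K := by
  rintro μ ⟨J, _, w, z, hw, hz, rfl⟩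
  have hP : IsProbabilityMeasure (discreteMeasure w z) := ⟨by
    simp only [discreteMeasure, Measure.coe_finsetSum, Finset.sum_apply, Measure.smul_apply,
      measure_univ, smul_eq_mul, mul_one]
    exact_mod_cast hw⟩
  have hI : ∀ x : X, (Measure.dirac x).InnerRegular := fun x => by
    refine ⟨fun s hs r hr => ?_⟩
    by_cases hx : x ∈ s
    · refine ⟨{x}, by simpa using hx, isCompact_singleton, ?_⟩
      simpa [hx, hs] using hr
    · simp [hs, hx] at hr
  have hI' : (discreteMeasure w z).InnerRegular := by
    unfold discreteMeasure; infer_instance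
  refine ⟨hP, inferInstance, ?_⟩
  simp only [discreteMeasure, Measure.coe_finsetSum, Finset.sum_apply, Measure.smul_apply,
    smul_eq_mul, Finset.sum_eq_zero_iff, mul_eq_zero]
  intro j _
  right
  simp [Measure.dirac_apply, hz j]

/-- The supremum over finitely supported probability measures on `K` of the minimum of the
potential on `K`. -/
noncomputable def maximinValue (k : X → X → ℝ≥0∞) (K : Set X) : ℝ≥0∞ :=
  ⨆ μ ∈ discreteProbOn K, ⨅ x ∈ K, potential k μ x

/-- The dual description of `maximinValue` on finitely many test points. -/
theorem exists_discreteProbOn_potential_le [MeasurableSingletonClass X] {k : X → X → ℝ≥0∞}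
    (hk : ∀ x y, k x y = k y x) {K : Set X} (hK : K.Nonempty) {c : ℝ≥0}
    (hc : maximinValue k K < c) (t : Finset X) (ht : ↑t ⊆ K) :
    ∃ μ ∈ discreteProbOn K, ∀ x ∈ t, potential k μ x ≤ c := by
  classical
  obtain ⟨x₀, hx₀⟩ := hK
  -- The point x₀ keeps the index type nonempty when t is empty.
  let ι := ↥(insert x₀ t)
  have : Nonempty ι := ⟨⟨x₀, Finset.mem_insert_self _ _⟩⟩
  have hιK : ∀ i : ι, (i : X) ∈ K := fun i => by
    rcases Finset.mem_insert.1 i.2 with h | h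
    · rw [h]; exact hx₀
    · exact ht h
  obtain ⟨a, ha, hac⟩ := ENNReal.lt_iff_exists_nnreal_btwn.1 hc
  obtain ⟨J, hJ, w, z, hw, hz, hwz⟩ := exists_weights_sum_le (fun (i : ι) y => k i y) K a c
    (by exact_mod_cast hac) (fun l hl => by
      by_contra! hcon
      refine absurd ha (not_lt.2 ?_)
      -- By symmetry of k, weights violating the minimax hypothesis are a measure whose potential
      -- exceeds a on K. Reindexing by `Fin` brings the index type into `Type`.
      let e := Fintype.equivFin ι
      refine le_trans ?_ (le_iSup₂_of_le (discreteMeasure (l ∘ e.symm) (fun j => (e.symm j : X)))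
        ⟨_, inferInstance, _, _, ?_, fun j => hιK _, rfl⟩ le_rfl)
      · refine le_iInf₂ fun y hy => (hcon y hy).le.trans (le_of_eq ?_)
        rw [potential_discreteMeasure, ← e.symm.sum_comp]
        simp [hk y]
      · rw [← hl, ← e.symm.sum_comp]
        rfl)
  refine ⟨_, ⟨J, hJ, w, z, hw, hz, rfl⟩, fun x hx => ?_⟩
  rw [potential_discreteMeasure]
  exact hwz ⟨x, Finset.mem_insert_of_mem hx⟩

end Discrete

/-! ### Weak duality and discretization -/

section Topological

variable {X : Type*} [TopologicalSpace X] [T2Space X] [MeasurableSpace X] [BorelSpace X]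

/-- Weak duality between a finitely supported measure and an arbitrary one. -/
theorem iInf_potential_le_iSup_potential {k : X → X → ℝ≥0∞}
    (hk_lsc : LowerSemicontinuous fun p : X × X => k p.1 p.2) (hk : ∀ x y, k x y = k y x)
    {K : Set X} {μ ν : Measure X} (hμ : μ ∈ discreteProbOn K) (hν : ν ∈ probMeasuresOn K) :
    ⨅ x ∈ K, potential k μ x ≤ ⨆ x ∈ K, potential k ν x := by
  obtain ⟨J, _, w, z, hw, hz, rfl⟩ := hμ
  obtain ⟨hP, -, hνK⟩ := hν
  have hmeas : ∀ y, Measurable fun x => k x y := fun y =>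
    (hk_lsc.comp (g := fun x : X => (x, y)) (by fun_prop)).measurable
  calc ⨅ x ∈ K, potential k (discreteMeasure w z) x
      = ∫⁻ _, (⨅ x ∈ K, potential k (discreteMeasure w z) x) ∂ν := by simp
    _ ≤ ∫⁻ x, potential k (discreteMeasure w z) x ∂ν := by
        refine lintegral_mono_ae ?_
        filter_upwards [mem_ae_iff.2 hνK] with x hx
        exact iInf₂_le x hx
    _ = ∑ j, (w j : ℝ≥0∞) * potential k ν (z j) := by
        simp only [potential_discreteMeasure]
        rw [lintegral_finsetSum _ fun j _ => (hmeas _).const_mul _]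
        refine Finset.sum_congr rfl fun j _ => ?_
        rw [lintegral_const_mul _ (hmeas _)]
        simp only [potential, hk (z j)]
    _ ≤ ∑ j, (w j : ℝ≥0∞) * ⨆ x ∈ K, potential k ν x := by
        gcongr with j
        exact le_iSup₂_of_le (z j) (hz j) le_rfl
    _ = _ := by
        rw [← Finset.sum_mul]
        have : ∑ j, (w j : ℝ≥0∞) = 1 := by exact_mod_cast hw
        rw [this, one_mul]

theorem maximinValue_le_iSup_potential {k : X → X → ℝ≥0∞}
    (hk_lsc : LowerSemicontinuous fun p : X × X => k p.1 p.2) (hk : ∀ x y, k x y = k y x)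
    {K : Set X} {ν : Measure X} (hν : ν ∈ probMeasuresOn K) :
    maximinValue k K ≤ ⨆ x ∈ K, potential k ν x :=
  iSup₂_le fun _ hμ => iInf_potential_le_iSup_potential hk_lsc hk hμ hν

/-- Simultaneous discretization of the integrals of finitely many bounded continuous functions. -/
theorem exists_discreteProbOn_lintegral_lt {K : Set X} {μ : Measure X} (hμ : μ ∈ probMeasuresOn K)
    {ι : Type*} [Fintype ι] (f : ι → X →ᵇ ℝ≥0) {c ε : ℝ≥0} (hε : 0 < ε)
    (hc : ∀ i, (c : ℝ≥0∞) < ∫⁻ x, f i x ∂μ) :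
    ∃ ρ ∈ discreteProbOn K, ∀ i, (c : ℝ≥0∞) ≤ ∫⁻ x, f i x ∂ρ + ε := by
  obtain ⟨hP, -, hμK⟩ := hμ
  let F : X → ι → ℝ := fun x i => f i x
  have hbd : ∀ i, ∃ C : ℝ≥0, ∀ x, f i x ≤ C := fun i => by
    obtain ⟨C, hC⟩ := (f i).isBounded_range.bddAbove
    exact ⟨C, fun x => hC (mem_range_self x)⟩
  have hint : ∀ i, Integrable (fun x => F x i) μ := fun i => by
    obtain ⟨C, hC⟩ := hbd i
    refine Integrable.of_bound (C := C) ?_ (ae_of_all _ fun x => ?_)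
    · exact ((NNReal.continuous_coe.comp (f i).continuous).measurable).aestronglyMeasurable
    · simpa [F] using hC x
  -- All the integrals form one vector, a barycenter of F(K); sup-norm approximation by the convex
  -- hull treats them at once.
  have hmem : (∫ x, F x ∂μ) ∈ closure (convexHull ℝ (F '' K)) := by
    refine Convex.integral_mem (convex_convexHull ℝ _).closure isClosed_closure ?_
      (Integrable.of_eval hint)
    filter_upwards [mem_ae_iff.2 hμK] with x hx
    exact subset_closure (subset_convexHull ℝ _ ⟨x, hx, rfl⟩)
  obtain ⟨t, ht, hdist⟩ := Metric.mem_closure_iff.1 hmem ε hε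
  obtain ⟨J, hJ, w, z, hw0, hw1, hz, hwz⟩ := mem_convexHull_iff_exists_fintype.1 ht
  choose y hyK hyz using hz
  obtain ⟨q, hq⟩ : ∃ q : J → ℝ≥0, ∀ j, (q j : ℝ) = w j := ⟨fun j => ⟨w j, hw0 j⟩, fun _ => rfl⟩
  refine ⟨discreteMeasure q y, ⟨J, hJ, q, y, ?_, hyK, rfl⟩, fun i => ?_⟩
  · rw [← NNReal.coe_inj]; push_cast; simpa only [hq] using hw1
  · have h1 : |(∫ x, F x ∂μ) i - t i| < ε := 
      lt_of_le_of_lt (dist_le_pi_dist (∫ x, F x ∂μ) t i) hdist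
    rw [eval_integral hint] at h1
    have h2 : (c : ℝ) < ∫ x, F x i ∂μ := by
      have h3 : ∫⁻ x, f i x ∂μ = ENNReal.ofReal (∫ x, F x i ∂μ) := by
        rw [ofReal_integral_eq_lintegral_ofReal (hint i) (ae_of_all _ fun x => (f i x).2)]
        simp [F]
      have h4 := hc i
      rw [h3, ← ENNReal.ofReal_coe_nnreal] at h4
      exact (ENNReal.ofReal_lt_ofReal_iff_of_nonneg c.2).1 h4
    rw [lintegral_discreteMeasure]
    have h5 : t i = (∑ j, q j * f i (y j) : ℝ≥0) := by
      rw [← hwz]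
      simp [← hyz, F, hq]
    have h6 : (c : ℝ) ≤ (∑ j, q j * f i (y j) : ℝ≥0) + ε := by
      rw [← h5]
      linarith [(abs_lt.1 h1).2]
    exact_mod_cast h6

omit [T2Space X] [MeasurableSpace X] [BorelSpace X] in
/-- Locally uniform comparison on a compact set of a continuous function of the second variable
with a lower semicontinuous function of both. -/
theorem eventually_forall_le_add {k : X → X → ℝ≥0∞}
    (hk_lsc : LowerSemicontinuous fun p : X × X => k p.1 p.2) {K : Set X} (hK : IsCompact K)
    {f : X → ℝ≥0∞} (hf : Continuous f) {x : X} (hfin : ∀ y, f y ≠ ∞) (hfk : ∀ y, f y ≤ k x y)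
    {ε : ℝ≥0} (hε : 0 < ε) : ∀ᶠ x' in 𝓝 x, ∀ y ∈ K, f y ≤ k x' y + ε := by
  have hopen : IsOpen {p : X × X | f p.2 < k p.1 p.2 + ε} :=
    isOpen_lt_of_lowerSemicontinuous (hf.comp continuous_snd)
      (hk_lsc.add lowerSemicontinuous_const)
  obtain ⟨u, v, hu, -, hxu, hKv, huv⟩ := generalized_tube_lemma (isCompact_singleton (x := x)) hK
    hopen (by
      rintro ⟨x', y⟩ ⟨rfl, -⟩
      exact (ENNReal.lt_add_right (hfin y) (by exact_mod_cast hε.ne')).trans_le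
        (add_le_add_left (hfk y) _))
  filter_upwards [hu.mem_nhds (hxu rfl)] with x' hx' y hy
  have h : (x', y) ∈ {p : X × X | f p.2 < k p.1 p.2 + ε} := huv ⟨hx', hKv hy⟩
  exact le_of_lt h

end Topological

/-! ### Strong duality for regular measures -/

section LocallyCompact

variable {X : Type*} [TopologicalSpace X] [LocallyCompactSpace X] [T2Space X] [MeasurableSpace X]
  [BorelSpace X]

/-- Finitely supported measures are as good as regular ones for maximizing the minimum of the
potential. -/
theorem iInf_potential_le_maximinValue {k : X → X → ℝ≥0∞}
    (hk_lsc : LowerSemicontinuous fun p : X × X => k p.1 p.2) {K : Set X} (hK : IsCompact K)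
    {μ : Measure X} (hμ : μ ∈ probMeasuresOn K) :
    ⨅ x ∈ K, potential k μ x ≤ maximinValue k K := by
  refine le_of_forall_lt_imp_le_of_dense fun c' hc' => ?_
  obtain ⟨d, hcd, hd⟩ := ENNReal.lt_iff_exists_nnreal_btwn.1 hc'
  lift c' to ℝ≥0 using (hcd.trans ENNReal.coe_lt_top).ne
  have hcd' : c' < d := by exact_mod_cast hcd
  -- One ε is lost in passing to a nearby point x, the other in discretizing μ.
  set ε : ℝ≥0 := (d - c') / 2 with hε_def
  have hε : 0 < ε := half_pos (tsub_pos_of_lt hcd')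
  have hdε : d = c' + ε + ε := by
    rw [hε_def, add_assoc, add_halves, add_tsub_cancel_of_le hcd'.le]
  have hx : ∀ x : K, ∃ f : X →ᵇ ℝ≥0, (∀ y, (f y : ℝ≥0∞) ≤ k x y) ∧
      (d : ℝ≥0∞) < ∫⁻ y, f y ∂μ := fun x =>
    exists_boundedContinuous_lt_lintegral hK hμ
      (hk_lsc.comp (g := fun y : X => ((x : X), y)) (by fun_prop))
      (hd.trans_le (iInf₂_le (x : X) x.2))
  choose f hfk hfd using hx
  have hev : ∀ x : K, {x' | ∀ y ∈ K, (f x y : ℝ≥0∞) ≤ k x' y + ε} ∈ 𝓝 (x : X) := fun x =>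
    eventually_forall_le_add hk_lsc hK
      (ENNReal.continuous_coe.comp (f x).continuous) (fun y => ENNReal.coe_ne_top) (hfk x) hε
  obtain ⟨t, ht⟩ := hK.elim_nhds_subcover' (fun x hx => {x' | ∀ y ∈ K, (f ⟨x, hx⟩ y : ℝ≥0∞) ≤
    k x' y + ε}) (fun x hx => hev ⟨x, hx⟩)
  obtain ⟨ρ, hρ, hρf⟩ := exists_discreteProbOn_lintegral_lt hμ (fun i : t => f i) hε
    (fun i => hfd i)
  refine le_iSup₂_of_le ρ hρ (le_iInf₂ fun x hxK => ?_)
  obtain ⟨i, hi, hxi⟩ := mem_iUnion₂.1 (ht hxK)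
  obtain ⟨hP, -, hρK⟩ := discreteProbOn_subset hρ
  have h1 : ∫⁻ y, f i y ∂ρ ≤ potential k ρ x + ε := by
    calc ∫⁻ y, f i y ∂ρ ≤ ∫⁻ y, (k x y + ε) ∂ρ := by
          refine lintegral_mono_ae ?_
          filter_upwards [mem_ae_iff.2 hρK] with y hy
          exact hxi y hy
      _ = _ := by rw [lintegral_add_right _ measurable_const]; simp [potential]
  have h2 := (hρf ⟨i, hi⟩).trans (add_le_add_left h1 _)
  rw [hdε, add_assoc, add_assoc, ENNReal.coe_add] at h2
  simpa using h2

/-- Above the maximin value there is a regular probability measure whose potential is bounded on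
the whole compact set. -/
theorem exists_potential_le {k : X → X → ℝ≥0∞}
    (hk_lsc : LowerSemicontinuous fun p : X × X => k p.1 p.2) (hk : ∀ x y, k x y = k y x)
    {K : Set X} (hK : IsCompact K) (hK_ne : K.Nonempty) {c : ℝ≥0} (hc : maximinValue k K < c) :
    ∃ ν ∈ probMeasuresOn K, ∀ x ∈ K, potential k ν x ≤ c := by
  classical
  have hfin : ∀ t : Finset K, ∃ μ ∈ discreteProbOn K, ∀ x ∈ t, potential k μ x ≤ c := fun t => by
    obtain ⟨μ, hμ, h⟩ := exists_discreteProbOn_potential_le hk hK_ne hc (t.image (↑)) (by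
      intro x hx
      obtain ⟨y, -, rfl⟩ := Finset.mem_image.1 hx
      exact y.2)
    exact ⟨μ, hμ, fun x hx => h x (Finset.mem_image_of_mem _ hx)⟩
  choose μ hμ hμc using hfin
  have hμ' := fun t => discreteProbOn_subset (hμ t)
  have hμP := fun t => (hμ' t).1
  let P : Finset K → FiniteMeasure X := fun t => ⟨μ t, inferInstance⟩
  let S : Set (FiniteMeasure X) := {p | p.mass ≤ 1 ∧ p Kᶜ = 0} ∩ {p | p.mass = 1}
  have hS : IsCompact S := (isCompact_setOfPred_finiteMeasure_le_of_isCompact 1 hK).inter_right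
    (isClosed_eq FiniteMeasure.continuous_mass continuous_const)
  have hPS : ∀ t, P t ∈ S := fun t => by
    have hmass : (P t).mass = 1 := by simp [FiniteMeasure.mass, P]
    refine ⟨⟨hmass.le, ?_⟩, hmass⟩
    rw [FiniteMeasure.null_iff_toMeasure_null]
    exact (hμ' t).2.2
  obtain ⟨p, ⟨⟨-, hp⟩, hp1⟩, hcl⟩ := hS.exists_mapClusterPt (f := atTop) (u := P)
    (tendsto_principal.2 (Eventually.of_forall hPS))
  have hpK : (p : Measure X) Kᶜ = 0 := by
    rwa [← FiniteMeasure.null_iff_toMeasure_null]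
  -- The cluster point p need not be regular; ν is regular and has the same integrals of bounded
  -- continuous functions.
  obtain ⟨ν, hνI, hνF, hνK, hν⟩ :=
    Measure.exists_innerRegular_eq_of_isCompact (p : Measure X) hK hpK
  have hνP : IsProbabilityMeasure ν := by
    have := hν 1
    simp only [BoundedContinuousFunction.coe_one, Pi.one_apply, integral_const, smul_eq_mul,
      mul_one] at this
    have hp1' : (p : Measure X) univ = 1 := by
      rw [← FiniteMeasure.ennreal_mass, show p.mass = 1 from hp1, ENNReal.coe_one]
    constructor
    rw [← hp1']
    exact ((measureReal_eq_measureReal_iff).1 this).symm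
  have hνM : ν ∈ probMeasuresOn K := ⟨hνP, inferInstance, hνK⟩
  refine ⟨ν, hνM, fun x hx => ?_⟩
  by_contra! hlt
  obtain ⟨f, hfk, hfc⟩ := exists_boundedContinuous_lt_lintegral hK hνM
      (hk_lsc.comp (g := fun y : X => (x, y)) (by fun_prop)) hlt
  have hpf : ∫⁻ y, f y ∂(p : Measure X) = ∫⁻ y, f y ∂ν := by
    rw [← ENNReal.toReal_eq_toReal_iff' (f.lintegral_lt_top_of_nnreal _).ne
      (f.lintegral_lt_top_of_nnreal _).ne, f.toReal_lintegral_coe_eq_integral,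
      f.toReal_lintegral_coe_eq_integral]
    exact hν (f.comp _ NNReal.isometry_coe.lipschitz)
  have hcont : Continuous fun q : FiniteMeasure X => ∫⁻ y, f y ∂(q : Measure X) :=
    FiniteMeasure.continuous_lintegral_boundedContinuousFunction f
  have hev : ∃ᶠ t in atTop, (c : ℝ≥0∞) < ∫⁻ y, f y ∂(P t : Measure X) := by
    refine hcl.frequently (p := fun q : FiniteMeasure X =>
      (c : ℝ≥0∞) < ∫⁻ y, f y ∂(q : Measure X)) (hcont.continuousAt.eventually (lt_mem_nhds ?_))
    change (c : ℝ≥0∞) < ∫⁻ y, f y ∂(p : Measure X)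
    rwa [hpf]
  -- Some finite set t containing x has ∫ f > c for its measure, although f ≤ k(x,·) and the
  -- potential at x is at most c.
  obtain ⟨t, ht1, ht2⟩ := (hev.and_eventually (eventually_ge_atTop {⟨x, hx⟩})).exists
  have h1 : ∫⁻ y, f y ∂(P t : Measure X) ≤ c :=
    (lintegral_mono fun y => hfk y).trans (hμc t ⟨x, hx⟩ (ht2 (Finset.mem_singleton_self _)))
  exact absurd h1 (not_le.2 ht1)

end LocallyCompact

/-! ### Approximation of weights by averages -/

/-- Natural numbers summing to `N` within a bounded distance of `N` times given weights. -/
theorem exists_nat_weights {J : Type*} [Fintype J] (w : J → ℝ≥0) (hw : ∑ j, w j = 1) (N : ℕ) :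
    ∃ m : J → ℕ, ∑ j, m j = N ∧ (∀ j, (m j : ℝ≥0) ≤ N * w j + Fintype.card J) ∧
      ∀ j, N * w j ≤ m j + Fintype.card J := by
  classical
  have hne : Nonempty J := by
    by_contra h
    rw [not_nonempty_iff] at h
    simp at hw
  obtain ⟨j₀⟩ := hne
  have hcard : 1 ≤ Fintype.card J := Fintype.card_pos_iff.2 ⟨j₀⟩
  let n : J → ℕ := fun j => ⌊N * w j⌋₊
  have hn1 : ∀ j, (n j : ℝ≥0) ≤ N * w j := fun j => Nat.floor_le zero_le
  have hn2 : ∀ j, N * w j ≤ n j + 1 := fun j => (Nat.lt_floor_add_one _).le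
  have hsum : ∑ j, (N : ℝ≥0) * w j = N := by rw [← Finset.mul_sum, hw, mul_one]
  have hle : ∑ j, n j ≤ N := by
    have := Finset.sum_le_sum fun j (_ : j ∈ Finset.univ) => hn1 j
    rw [hsum] at this
    exact_mod_cast this
  have hge : N ≤ ∑ j, n j + Fintype.card J := by
    have := Finset.sum_le_sum fun j (_ : j ∈ Finset.univ) => hn2 j
    rw [hsum, Finset.sum_add_distrib] at this
    simp only [Finset.sum_const, Finset.card_univ, nsmul_eq_mul, mul_one] at this
    exact_mod_cast this
  -- Rounding down leaves a deficit of at most the number of indices, all assigned to j₀; hence the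
  -- error bound `Fintype.card J`.
  let R := N - ∑ j, n j
  have hR : R ≤ Fintype.card J := by omega
  have hR' : (R : ℝ≥0) ≤ Fintype.card J := by exact_mod_cast hR
  refine ⟨fun j => n j + if j = j₀ then R else 0, ?_, fun j => ?_, fun j => ?_⟩
  · rw [Finset.sum_add_distrib]
    simp only [Finset.sum_ite_eq', Finset.mem_univ, if_true]
    omega
  · push_cast
    refine add_le_add (hn1 j) ?_
    split_ifs
    · exact hR'
    · simp
  · refine (hn2 j).trans (add_le_add ?_ (by exact_mod_cast hcard))
    push_cast
    exact le_self_add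

/-- Convex combinations of bounded functions are uniformly approximated by averages. -/
theorem exists_average_approx {X : Type*} {K : Set X} {J : Type*} [Fintype J] (w : J → ℝ≥0)
    (hw : ∑ j, w j = 1) {z : J → X} (hz : ∀ j, z j ∈ K) (M : ℝ≥0) {ε : ℝ≥0} (hε : 0 < ε) :
    ∃ (N : ℕ) (v : Fin N → X), 1 ≤ N ∧ (∀ i, v i ∈ K) ∧ ∀ g : X → ℝ≥0∞, (∀ x ∈ K, g x ≤ M) →
      (N : ℝ≥0∞)⁻¹ * ∑ i, g (v i) ≤ ∑ j, (w j : ℝ≥0∞) * g (z j) + ε ∧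
      ∑ j, (w j : ℝ≥0∞) * g (z j) ≤ (N : ℝ≥0∞)⁻¹ * ∑ i, g (v i) + ε := by
  set n : ℝ≥0 := (Fintype.card J : ℝ≥0) with hn
  -- Each of the n multiplicities is off by at most n and g ≤ M, so the total error n * (n * M) must
  -- be at most N * ε.
  obtain ⟨N₀, hN₀⟩ := exists_nat_ge (n * (n * M) / ε)
  let N := N₀ + 1
  have hN1 : 1 ≤ N := by omega
  have hNpos : (0 : ℝ≥0) < N := by exact_mod_cast hN1
  have hN : n * (n * M) ≤ N * ε := by
    rw [div_le_iff₀ hε] at hN₀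
    refine hN₀.trans ?_
    gcongr
    omega
  have hN0 : (N : ℝ≥0∞) ≠ 0 := by exact_mod_cast hNpos.ne'
  obtain ⟨m, hm, hm1, hm2⟩ := exists_nat_weights w hw N
  change ∀ j, (m j : ℝ≥0) ≤ N * w j + n at hm1
  change ∀ j, N * w j ≤ (m j : ℝ≥0) + n at hm2
  let e : (Σ j, Fin (m j)) ≃ Fin N := Fintype.equivFinOfCardEq (by simp [hm])
  refine ⟨N, fun i => z (e.symm i).1, hN1, fun i => hz _, fun g hg => ?_⟩
  have hsum : ∑ i, g (z (e.symm i).1) = ∑ j, (m j : ℝ≥0∞) * g (z j) := by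
    rw [e.symm.sum_comp (fun p => g (z p.1)), Fintype.sum_sigma]
    simp
  have herr : ∑ _j : J, (n : ℝ≥0∞) * M ≤ N * ε := by
    rw [Finset.sum_const, Finset.card_univ, nsmul_eq_mul]
    exact_mod_cast hN
  have hmul : (N : ℝ≥0∞) * ∑ j, (w j : ℝ≥0∞) * g (z j) = ∑ j, (N * w j : ℝ≥0∞) * g (z j) := by
    rw [Finset.mul_sum]
    exact Finset.sum_congr rfl fun j _ => (mul_assoc _ _ _).symm
  rw [hsum]
  constructor
  · rw [ENNReal.inv_mul_le_iff hN0 (by simp), mul_add, hmul]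
    refine le_trans ?_ (add_le_add_right herr _)
    rw [← Finset.sum_add_distrib]
    refine Finset.sum_le_sum fun j _ => ?_
    have h1 : (m j : ℝ≥0∞) ≤ N * w j + n := by exact_mod_cast hm1 j
    calc (m j : ℝ≥0∞) * g (z j) ≤ (N * w j + n) * g (z j) := by gcongr
      _ ≤ _ := by rw [add_mul]; gcongr; exact hg _ (hz j)
  · rw [← ENNReal.mul_le_mul_iff_right hN0 (by simp), mul_add, hmul,
      ENNReal.mul_inv_cancel_left hN0 (by simp)]
    refine le_trans ?_ (add_le_add_right herr _)
    rw [← Finset.sum_add_distrib]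
    refine Finset.sum_le_sum fun j _ => ?_
    have h1 : (N * w j : ℝ≥0∞) ≤ m j + n := by exact_mod_cast hm2 j
    calc (N * w j : ℝ≥0∞) * g (z j) ≤ (m j + n) * g (z j) := by gcongr
      _ ≤ _ := by rw [add_mul]; gcongr; exact hg _ (hz j)

/-! ### Finite continuous kernels -/

section Continuous

variable {X : Type*} [TopologicalSpace X] [T2Space X] [MeasurableSpace X] [BorelSpace X]

/-- For a finite continuous kernel, the measure in `exists_potential_le` can be taken finitely
supported. -/
theorem exists_discreteProbOn_potential_le_on {k : X → X → ℝ≥0∞} (hfin : ∀ x y, k x y ≠ ∞)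
    (hcont : Continuous fun p : X × X => k p.1 p.2) (hk : ∀ x y, k x y = k y x)
    {K : Set X} (hK : IsCompact K) (hK_ne : K.Nonempty) {c : ℝ≥0} (hc : maximinValue k K < c) :
    ∃ ρ ∈ discreteProbOn K, ∀ x ∈ K, potential k ρ x ≤ c := by
  obtain ⟨d, hd, hdc⟩ := ENNReal.lt_iff_exists_nnreal_btwn.1 hc
  have hdc' : d < c := by exact_mod_cast hdc
  have hε : 0 < c - d := tsub_pos_of_lt hdc'
  -- Continuity bounds k(x',·) from above, uniformly on K, so a bound at finitely many points
  -- spreads to K at the cost c - d.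
  have hev : ∀ x ∈ K, {x' | ∀ y ∈ K, k x' y ≤ k x y + (c - d : ℝ≥0)} ∈ 𝓝 x := by
    intro x _
    have hopen : IsOpen {p : X × X | k p.1 p.2 < k x p.2 + (c - d : ℝ≥0)} :=
      isOpen_lt hcont ((hcont.comp (by fun_prop : Continuous fun p : X × X => (x, p.2))).add
        continuous_const)
    obtain ⟨u, v, hu, -, hxu, hKv, huv⟩ := generalized_tube_lemma (isCompact_singleton (x := x)) hK
      hopen (by
        rintro ⟨x', y⟩ ⟨rfl, -⟩
        exact ENNReal.lt_add_right (hfin _ _) (by exact_mod_cast hε.ne'))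
    filter_upwards [hu.mem_nhds (hxu rfl)] with x' hx' y hy
    have h : (x', y) ∈ {p : X × X | k p.1 p.2 < k x p.2 + (c - d : ℝ≥0)} := huv ⟨hx', hKv hy⟩
    exact le_of_lt h
  obtain ⟨t, htK, ht⟩ := hK.elim_nhds_subcover _ hev
  obtain ⟨ρ, hρ, hρt⟩ := exists_discreteProbOn_potential_le hk hK_ne hd t htK
  refine ⟨ρ, hρ, fun x hx => ?_⟩
  obtain ⟨x₀, hx₀, hxx₀⟩ := mem_iUnion₂.1 (ht hx)
  obtain ⟨hP, -, hρK⟩ := discreteProbOn_subset hρ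
  calc potential k ρ x ≤ ∫⁻ y, (k x₀ y + (c - d : ℝ≥0)) ∂ρ := by
        refine lintegral_mono_ae ?_
        filter_upwards [mem_ae_iff.2 hρK] with y hy
        exact hxx₀ y hy
    _ = potential k ρ x₀ + (c - d : ℝ≥0) := by
        rw [lintegral_add_right _ measurable_const]; simp [potential]
    _ ≤ d + (c - d : ℝ≥0) := by gcongr; exact hρt x₀ hx₀
    _ = c := by rw [← ENNReal.coe_add, add_tsub_cancel_of_le hdc'.le]

/-- Averages over finite families are potentials of finitely supported measures. -/
theorem exists_discreteProbOn_potential_eq_average {K : Set X} {N : ℕ} (hN : 1 ≤ N) {v : Fin N → X}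
    (hv : ∀ i, v i ∈ K) (k : X → X → ℝ≥0∞) :
    ∃ ρ ∈ discreteProbOn K, ∀ x, potential k ρ x = (N : ℝ≥0∞)⁻¹ * ∑ i, k x (v i) := by
  have hN0 : (N : ℝ≥0) ≠ 0 := by exact_mod_cast (by omega : N ≠ 0)
  refine ⟨discreteMeasure (fun _ => (N : ℝ≥0)⁻¹) v, ⟨Fin N, inferInstance, _, v, ?_, hv, rfl⟩,
    fun x => ?_⟩
  · simp [hN0]
  · rw [potential_discreteMeasure, Finset.mul_sum, ENNReal.coe_inv hN0, ENNReal.coe_natCast]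

/-- For a finite continuous kernel, potentials of finitely supported measures are uniformly
approximated on `K` by averages. -/
theorem exists_average_approx_potential {k : X → X → ℝ≥0∞} (hfin : ∀ x y, k x y ≠ ∞)
    (hcont : Continuous fun p : X × X => k p.1 p.2) {K : Set X} (hK : IsCompact K)
    {ρ : Measure X} (hρ : ρ ∈ discreteProbOn K) {ε : ℝ≥0} (hε : 0 < ε) :
    ∃ (N : ℕ) (v : Fin N → X), 1 ≤ N ∧ (∀ i, v i ∈ K) ∧ ∀ x ∈ K,
      (N : ℝ≥0∞)⁻¹ * ∑ i, k x (v i) ≤ potential k ρ x + ε ∧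
      potential k ρ x ≤ (N : ℝ≥0∞)⁻¹ * ∑ i, k x (v i) + ε := by
  obtain ⟨J, _, w, z, hw, hz, rfl⟩ := hρ
  obtain ⟨M, hM⟩ : ∃ M : ℝ≥0, ∀ x ∈ K, ∀ y ∈ K, k x y ≤ M := by
    rcases K.eq_empty_or_nonempty with rfl | hne
    · exact ⟨0, by simp⟩
    · obtain ⟨p, -, hp⟩ := (hK.prod hK).exists_isMaxOn (hne.prod hne) hcont.continuousOn
      refine ⟨(k p.1 p.2).toNNReal, fun x hx y hy => ?_⟩
      rw [ENNReal.coe_toNNReal (hfin _ _)]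
      exact hp (mk_mem_prod hx hy)
  obtain ⟨N, v, hN, hv, h⟩ := exists_average_approx w hw hz M hε
  refine ⟨N, v, hN, hv, fun x hx => ?_⟩
  rw [potential_discreteMeasure]
  exact h (k x) (hM x hx)

end Continuous

/-! ### Average and rendezvous sets as singletons -/

section Main

variable {X : Type*} [TopologicalSpace X] [LocallyCompactSpace X] [T2Space X] [MeasurableSpace X]
  [BorelSpace X] {k : X → X → ℝ≥0∞} {K : Set X}

/-- The average set of a compact set is the singleton of the maximin value. -/
theorem averageSet_eq_singleton (hk_lsc : LowerSemicontinuous fun p : X × X => k p.1 p.2)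
    (hk : ∀ x y, k x y = k y x) (hK : IsCompact K) (hK_ne : K.Nonempty) :
    averageSet k K = {maximinValue k K} := by
  ext r
  simp only [averageSet, averageSet₂, closedConv_eq_Icc, mem_iInter, mem_Icc, sInf_image,
    sSup_image, mem_singleton_iff]
  refine ⟨fun h => le_antisymm (le_of_forall_gt_imp_ge_of_dense fun c hc => ?_)
    (iSup₂_le fun μ hμ => (h μ (discreteProbOn_subset hμ)).1), ?_⟩
  · rcases eq_or_ne c ∞ with rfl | hct
    · exact le_top
    lift c to ℝ≥0 using hct
    obtain ⟨ν, hν, hνc⟩ := exists_potential_le hk_lsc hk hK hK_ne hc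
    exact (h ν hν).2.trans (iSup₂_le hνc)
  · rintro rfl μ hμ
    exact ⟨iInf_potential_le_maximinValue hk_lsc hK hμ,
      maximinValue_le_iSup_potential hk_lsc hk hμ⟩

omit [LocallyCompactSpace X] in
/-- For a finite continuous kernel, the rendezvous set of a compact set is the singleton of the
maximin value. -/
theorem rendezvousSet_eq_singleton (hfin : ∀ x y, k x y ≠ ∞)
    (hcont : Continuous fun p : X × X => k p.1 p.2)
    (hk : ∀ x y, k x y = k y x) (hK : IsCompact K) (hK_ne : K.Nonempty) :
    rendezvousSet k K = {maximinValue k K} := by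
  ext r
  simp only [rendezvousSet, rendezvousSet₂, nthRendezvousSet₂, closedConv_eq_Icc, mem_iInter,
    mem_Icc, sInf_image, sSup_image, mem_singleton_iff]
  refine ⟨fun h => le_antisymm (le_of_forall_gt_imp_ge_of_dense fun c hc => ?_)
    (iSup₂_le fun ρ hρ => ENNReal.le_of_forall_pos_le_add fun ε hε _ => ?_), ?_⟩
  · rcases eq_or_ne c ∞ with rfl | hct
    · exact le_top
    lift c to ℝ≥0 using hct
    obtain ⟨ρ, hρ, hρc⟩ := exists_discreteProbOn_potential_le_on hfin hcont hk hK hK_ne hc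
    refine ENNReal.le_of_forall_pos_le_add fun ε hε _ => ?_
    obtain ⟨N, v, hN, hv, happ⟩ := exists_average_approx_potential hfin hcont hK hρ hε
    exact (h N hN v hv).2.trans (iSup₂_le fun x hx =>
      (happ x hx).1.trans (add_le_add_left (hρc x hx) _))
  · obtain ⟨N, v, hN, hv, happ⟩ := exists_average_approx_potential hfin hcont hK hρ hε
    refine le_trans ?_ (add_le_add_left (h N hN v hv).1 _)
    simp only [ENNReal.iInf_add]
    exact le_iInf₂ fun x hx => (iInf₂_le x hx).trans (happ x hx).2
  · rintro rfl N hN v hv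
    -- An average is itself the potential of a discrete measure, so the maximin value lies in each
    -- interval by weak duality.
    obtain ⟨ρ, hρ, hρv⟩ := exists_discreteProbOn_potential_eq_average hN hv k
    simp only [← hρv]
    exact ⟨le_iSup₂_of_le ρ hρ le_rfl, maximinValue_le_iSup_potential
      hcont.lowerSemicontinuous hk (discreteProbOn_subset hρ)⟩

end Main

end Rendezvous

theorem mainTheorem1 {X : Type*} [TopologicalSpace X] [LocallyCompactSpace X] [T2Space X]
    [MeasurableSpace X] [BorelSpace X]
    (k : X → X → ℝ≥0∞)
    (hk_lsc : LowerSemicontinuous (fun p : X × X => k p.1 p.2))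
    (hk_symm : ∀ x y, k x y = k y x)
    (K : Set X) (hK : IsCompact K) (hK_ne : K.Nonempty) :
    (∃ r : ℝ≥0∞, Rendezvous.averageSet k K = {r}) ∧
      ((∀ x y, k x y ≠ ∞) → Continuous (fun p : X × X => k p.1 p.2) →
        ∃ r : ℝ≥0∞, Rendezvous.rendezvousSet k K = {r}) :=
  ⟨⟨_, Rendezvous.averageSet_eq_singleton hk_lsc hk_symm hK hK_ne⟩, fun hfin hcont =>
    ⟨_, Rendezvous.rendezvousSet_eq_singleton hfin hcont hk_symm hK hK_ne⟩⟩
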